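/- Let $n\ge 0$. The rook monoid $R_n$ is the monoid, under matrix multiplication, of the $n\times n$ matrices with entries in $\{0,1\}$ and at most one nonzero entry in each row and in each column. A rook $r\in R_n$ is identified with its rook vector $(r_1,\dots,r_n)$, where $r_j$ is the index of the row containing the $1$ of column $j$, and $r_j=0$ if column $j$ is zero. Let $s_k\in R_n$ ($1\le k\le n-1$) be the permutation matrix of the transposition $(k,k+1)$, and for $n\ge 1$ let $P_1=\mathrm{diag}(0,1,\dots,1)\in R_n$. Let $\pi_0$ denote $P_1$, and also the operator $r\mapsto r\cdot\pi_0:=rP_1$ on $R_n$. For $1\le k\le n-1$ let $\pi_k$ be the operator on $R_n$ given by $r\cdot\pi_k=r s_k$ if $r_k<r_{k+1}$, and $r\cdot\pi_k=r$ otherwise. The $0$-rook monoid $R_n^0$ is the monoid of operators on $R_n$, acting on the right, generated by $\pi_0,\pi_1,\dots,\pi_{n-1}$. A word in the generators is reduced if it has minimal length among the words in these generators with the same value. **Theorem.** (1) Let $u,v$ be two reduced words over $\{\pi_0,s_1,\dots,s_{n-1}\}$ for the same element of $R_n$. Then $u$ and $v$ are congruent using only the braid relations $$s_is_{i+1}s_i=s_{i+1}s_is_{i+1}\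 (1\le i\le n-2),\qquad s_is_j=s_js_i\ (|i-j|\ge 2),\qquad \pi_0s_j=s_j\pi_0\ (j\ne 1).$$ (2) Let $u,v$ be two reduced words over $\{\pi_0,\pi_1,\dots,\pi_{n-1}\}$ for the same element of $R_n^0$. Then $u$ and $v$ are congruent using only the braid relations $$\pi_i\pi_{i+1}\pi_i=\pi_{i+1}\pi_i\pi_{i+1}\ (1\le i\le n-2),\qquad \pi_i\pi_j=\pi_j\pi_i\ (0\le i,j\le n-1,\ |i-j|\ge 2).$$ (3) Consequently, reduced words for $R_n$ and $R_n^0$ coincide: let $w^1$ be a word over $\{\pi_0,s_1,\dots,s_{n-1}\}$, and let $w^0$ be the word obtained from it by replacing each $s_i$ by $\pi_i$ and keeping $\pi_0$. Then $w^1$ is reduced if and only if $w^0$ is reduced. Moreover, in that case, writing $\ell$ for the common length and $1_n$ for the identity matrix, one has $1_n\cdot w^1_1\cdots w^1_k=1_n\cdot w^0_1\cdots w^0_k$ for every $k=0,\dots,\ell$, and the $\ell+1$ rooks $1_n\cdot w^0_1\cdots w^0_k$ ($0\le k\le\ell$) are pairwise distinct. -/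

import Mathlib

/-- The rook monoid `R_n`: the submonoid of the `n × n` matrices formed by the rook matrices,
i.e. the matrices with entries in `{0, 1}` and at most one nonzero entry in each row and in each
column. -/
def rookMonoid (n : ℕ) : Submonoid (Matrix (Fin n) (Fin n) ℕ) where
  carrier := {M | (∀ i j, M i j = 0 ∨ M i j = 1) ∧
    (∀ i j j', M i j ≠ 0 → M i j' ≠ 0 → j = j') ∧
    (∀ i i' j, M i j ≠ 0 → M i' j ≠ 0 → i = i')}
  one_mem' := by
    refine ⟨fun i j => ?_, fun i j j' h h' => ?_, fun i i' j h h' => ?_⟩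
    · by_cases hij : i = j <;> simp [Matrix.one_apply, hij]
    · simp only [Matrix.one_apply, ne_eq, ite_eq_right_iff, not_forall] at h h'
      exact h.1.symm.trans h'.1
    · simp only [Matrix.one_apply, ne_eq, ite_eq_right_iff, not_forall] at h h'
      exact h.1.trans h'.1.symm
  mul_mem' := by
    rintro A B ⟨hA, hAr, hAc⟩ ⟨hB, hBr, hBc⟩
    have key : ∀ i j, (A * B) i j ≠ 0 → ∃ k, A i k ≠ 0 ∧ B k j ≠ 0 := by
      intro i j h
      rw [Matrix.mul_apply] at h
      obtain ⟨k, -, hk⟩ := Finset.exists_ne_zero_of_sum_ne_zero h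
      exact ⟨k, left_ne_zero_of_mul hk, right_ne_zero_of_mul hk⟩
    refine ⟨fun i j => ?_, fun i j j' h h' => ?_, fun i i' j h h' => ?_⟩
    · by_cases h : (A * B) i j = 0
      · exact Or.inl h
      · obtain ⟨k, hk, hk'⟩ := key i j h
        right
        rw [Matrix.mul_apply, Finset.sum_eq_single k]
        · rw [(hA i k).resolve_left hk, (hB k j).resolve_left hk', one_mul]
        · intro l _ hl
          by_contra hne
          exact hl (hAr i l k (left_ne_zero_of_mul hne) hk)
        · simp
    · obtain ⟨k, hk, hk'⟩ := key i j h
      obtain ⟨l, hl, hl'⟩ := key i j' h'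
      obtain rfl := hAr i k l hk hl
      exact hBr k j j' hk' hl'
    · obtain ⟨k, hk, hk'⟩ := key i j h
      obtain ⟨l, hl, hl'⟩ := key i' j h'
      obtain rfl := hBc k l j hk' hl'
      exact hAc i i' k hk hl

/-- The rook vector `(r_1, …, r_n)` of a rook: `r_j` is the (1-based) index of the row containing
the `1` of column `j`, and `0` if column `j` is zero. -/
def rookVector {n : ℕ} (r : rookMonoid n) (j : Fin n) : ℕ :=
  ∑ i : Fin n, if r.1 i j = 1 then i.val + 1 else 0

/-- The preceding index (only used for `k ≠ 0`). -/
def prevIdx {n : ℕ} (k : Fin n) : Fin n := ⟨k.val - 1, by omega⟩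

/-- The matrices of the generators of `R_n`, indexed by `0, …, n - 1`: index `0` is the diagonal
matrix `diag(0, 1, …, 1)`, and index `k ≥ 1` is the matrix `s_k` of the elementary transposition
`(k, k + 1)` (rows and columns numbered from `1`, so it involves the positions `k - 1` and `k` of
`Fin n`). -/
def rookGenMatrix {n : ℕ} (k : Fin n) : Matrix (Fin n) (Fin n) ℕ :=
  if k.val = 0 then Matrix.diagonal fun i => if i.val = 0 then 0 else 1
  else Matrix.swap ℕ (prevIdx k) k

theorem rookGenMatrix_mem {n : ℕ} (k : Fin n) : rookGenMatrix k ∈ rookMonoid n := by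
  unfold rookGenMatrix
  split_ifs with hk
  · refine ⟨fun i j => ?_, fun i j j' h h' => ?_, fun i i' j h h' => ?_⟩
    · simp only [Matrix.diagonal_apply]
      split_ifs <;> simp
    · simp only [Matrix.diagonal_apply, ne_eq, ite_eq_right_iff, not_forall] at h h'
      exact h.1.symm.trans h'.1
    · simp only [Matrix.diagonal_apply, ne_eq, ite_eq_right_iff, not_forall] at h h'
      exact h.1.trans h'.1.symm
  · have key : ∀ i j, Matrix.swap ℕ (prevIdx k) k i j
        = if Equiv.swap (prevIdx k) k i = j then 1 else 0 := by
      intro i j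
      simp [Matrix.swap, Equiv.Perm.permMatrix, PEquiv.toMatrix_apply, eq_comm]
    refine ⟨fun i j => ?_, fun i j j' h h' => ?_, fun i i' j h h' => ?_⟩
    · rw [key]
      split_ifs <;> simp
    · simp only [key, ne_eq, ite_eq_right_iff, not_forall] at h h'
      exact h.1.symm.trans h'.1
    · simp only [key, ne_eq, ite_eq_right_iff, not_forall] at h h'
      exact (Equiv.swap (prevIdx k) k).injective (h.1.trans h'.1.symm)

/-- The generators `π_0 = P_1, s_1, …, s_{n-1}` of the rook monoid `R_n`. -/
def rookGen (n : ℕ) (k : Fin n) : rookMonoid n := ⟨rookGenMatrix k, rookGenMatrix_mem k⟩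

/-- The operators `r ↦ r · π_k` on rooks: `π_0` acts as right multiplication by `P_1`; for `k ≥ 1`,
`r · π_k` is `r · s_k` if `r_k < r_{k+1}`, and `r` otherwise. -/
def zeroRookOp {n : ℕ} (k : Fin n) : Function.End (rookMonoid n) := fun r =>
  if k.val = 0 ∨ rookVector r (prevIdx k) < rookVector r k then r * rookGen n k else r

/-- The `0`-rook monoid `R_n^0`: the monoid of operators on `R_n` generated by
`π_0, π_1, …, π_{n-1}`. The operators act on the right, so the product is composition from left to
right, i.e. it is taken in the opposite of the monoid of self-maps. -/
def zeroRookMonoid (n : ℕ) : Submonoid (Function.End (rookMonoid n))ᵐᵒᵖ :=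
  Submonoid.closure (Set.range fun k : Fin n => MulOpposite.op (zeroRookOp k))

/-- The generators `π_0, π_1, …, π_{n-1}` of the `0`-rook monoid `R_n^0`. -/
def zeroRookGen (n : ℕ) (k : Fin n) : zeroRookMonoid n :=
  ⟨MulOpposite.op (zeroRookOp k), Submonoid.subset_closure ⟨k, rfl⟩⟩

/-- The right action of an element of `R_n^0` on a rook. -/
def zeroRookAct {n : ℕ} (r : rookMonoid n) (x : zeroRookMonoid n) : rookMonoid n := x.1.unop r

/-- The word `w` is a reduced word for `x` with respect to the family `g` of generators: its value
is `x`, and no shorter word has value `x`. -/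
def IsReducedWordFor {ι M : Type*} [Monoid M] (g : ι → M) (w : FreeMonoid ι) (x : M) : Prop :=
  FreeMonoid.lift g w = x ∧
    ∀ w' : FreeMonoid ι, FreeMonoid.lift g w' = x → w.length ≤ w'.length

/-- The word `w` is reduced, i.e. it is a reduced word for its own value. -/
def IsReducedWord {ι M : Type*} [Monoid M] (g : ι → M) (w : FreeMonoid ι) : Prop :=
  IsReducedWordFor g w (FreeMonoid.lift g w)

/-- The braid relations between words in the letters `0, …, n - 1`. -/
inductive BraidRel (n : ℕ) : FreeMonoid (Fin n) → FreeMonoid (Fin n) → Prop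
  | braid (i j : Fin n) (hi : 1 ≤ i.val) (hj : j.val = i.val + 1) :
      BraidRel n (FreeMonoid.of i * FreeMonoid.of j * FreeMonoid.of i)
        (FreeMonoid.of j * FreeMonoid.of i * FreeMonoid.of j)
  | comm (i j : Fin n) (h : i.val + 2 ≤ j.val ∨ j.val + 2 ≤ i.val) :
      BraidRel n (FreeMonoid.of i * FreeMonoid.of j) (FreeMonoid.of j * FreeMonoid.of i)

/-- The congruence on words generated by the braid relations. -/
def braidCon (n : ℕ) : Con (FreeMonoid (Fin n)) := conGen (BraidRel n)

/-- The prefix of length `k` of a word. -/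
def wordPrefix {ι : Type*} (w : FreeMonoid ι) (k : ℕ) : FreeMonoid ι :=
  FreeMonoid.ofList (w.toList.take k)

/-!
A rook is encoded by its rook vector. Right multiplication by `s_k` exchanges two adjacent entries,
and `π_0` erases the first entry. Both actions are controlled by one function on rook vectors,
`level v = #(inversions of v) - (sum of the entries of v)`. No letter raises it by more than one, in
either action, and the letters which raise it (`Asc`) act in the same way in both actions. For
`π_0` this happens exactly when the erased entry exceeds every missing value. Thus the last step of
a level-raising path can be undone in only one way: the entry to restore is the largest missing
value (`Asc.act_injective`, `Desc.exists_pred`). Every rook other than the identity has such a last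
step, so every rook is reached from the identity by an ascending word (`exists_ascWord`).

Any two ascending words for the same rook are congruent by braid relations (`AscWord.braidCon`), by
induction on the length. If the last letters differ, there are ascending words which end with the
two sides of a braid relation and whose last letters are the given ones. The letters `0` and `1`,
for which there is no relation, cannot both be last letters: the first entry would be `0` and larger
than the second.

In `R_n` a word is determined by its value on the identity, so the reduced words are the ascending
words. In `R_n^0` the same follows once an operator is known to be determined by its value on the
identity (`run_zeroAct_congr`). This holds since the operators commute with analogous operators on
the values of a rook vector (`leftAct_zeroAct`), by which every rook is obtained from the identity.
-/

namespace RookWord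

variable {n : ℕ}

/-! ### Rook vectors and the two actions on them -/

/-- `v` is the vector of a rook: its entries lie in `{0, …, n}` and no nonzero entry is repeated. -/
def IsRookVector (v : Fin n → ℕ) : Prop :=
  (∀ i, v i ≤ n) ∧ ∀ i j, v i = v j → v i ≠ 0 → i = j

/-- The vector `(1, …, n)` of the identity rook. -/
def idVector (n : ℕ) : Fin n → ℕ := fun i => i.val + 1

/-- Right multiplication by the generator `k` of `R_n`, on vectors. -/
def act (k : Fin n) (v : Fin n → ℕ) : Fin n → ℕ :=
  if k.val = 0 then Function.update v k 0 else v ∘ Equiv.swap (prevIdx k) k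

/-- The operator `π_k`, on vectors. -/
def zeroAct (k : Fin n) (v : Fin n → ℕ) : Fin n → ℕ :=
  if k.val = 0 ∨ v (prevIdx k) < v k then act k v else v

theorem act_zero {k : Fin n} (hk : k.val = 0) (v : Fin n → ℕ) :
    act k v = Function.update v k 0 := if_pos hk

theorem act_pos {k : Fin n} (hk : k.val ≠ 0) (v : Fin n → ℕ) :
    act k v = v ∘ Equiv.swap (prevIdx k) k := if_neg hk

theorem prevIdx_val (k : Fin n) : (prevIdx k).val = k.val - 1 := rfl

theorem IsRookVector.comp_equiv {v : Fin n → ℕ} (hv : IsRookVector v) (e : Equiv.Perm (Fin n)) :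
    IsRookVector (v ∘ e) :=
  ⟨fun _ => hv.1 _, fun _ _ h h0 => e.injective (hv.2 _ _ h h0)⟩

theorem IsRookVector.act {v : Fin n → ℕ} (hv : IsRookVector v) (k : Fin n) :
    IsRookVector (act k v) := by
  by_cases hk : k.val = 0
  · rw [act_zero hk]
    refine ⟨fun i => ?_, fun i j => ?_⟩
    · rw [Function.update_apply]
      split_ifs
      exacts [Nat.zero_le _, hv.1 i]
    · simp only [Function.update_apply]
      split_ifs with h1 h2 h2
      · simp
      · simp
      · exact fun h h' => absurd h h'
      · exact hv.2 i j
  · rw [act_pos hk]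
    exact hv.comp_equiv _

theorem IsRookVector.zeroAct {v : Fin n → ℕ} (hv : IsRookVector v) (k : Fin n) :
    IsRookVector (zeroAct k v) := by
  unfold RookWord.zeroAct
  split_ifs
  exacts [hv.act k, hv]

theorem isRookVector_idVector (n : ℕ) : IsRookVector (idVector n) :=
  ⟨fun i => i.isLt, fun _ _ h _ => Fin.ext (Nat.succ.inj h)⟩

/-! ### The length function -/

/-- The pairs of positions `i < j` with `v i > v j`. -/
def inversions (v : Fin n → ℕ) : Finset (Fin n × Fin n) :=
  Finset.univ.filter fun p => p.1 < p.2 ∧ v p.2 < v p.1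

/-- The length of a rook, up to an additive constant: the number of inversions minus the sum of the
entries. Adding `1 + ⋯ + n` turns the second term into the sum of the missing values. -/
def level (v : Fin n → ℕ) : ℤ := (inversions v).card - ∑ i, (v i : ℤ)

/-- The letter `k` takes `v` one level up. For the letter `0` this requires that the entry which is
erased be larger than all the missing values. -/
def Asc (k : Fin n) (v : Fin n → ℕ) : Prop :=
  if k.val = 0 then 0 < v k ∧ ∀ b, v k < b → b ≤ n → ∃ i, v i = b else v (prevIdx k) < v k

/-- The letter `k` is a possible last letter of a reduced word for `v`. -/
def Desc (k : Fin n) (v : Fin n → ℕ) : Prop :=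
  if k.val = 0 then v k = 0 else v k < v (prevIdx k)

theorem asc_zero {k : Fin n} (hk : k.val = 0) (v : Fin n → ℕ) :
    Asc k v ↔ 0 < v k ∧ ∀ b, v k < b → b ≤ n → ∃ i, v i = b := by
  rw [Asc, if_pos hk]

theorem asc_pos {k : Fin n} (hk : k.val ≠ 0) (v : Fin n → ℕ) :
    Asc k v ↔ v (prevIdx k) < v k := by
  rw [Asc, if_neg hk]

theorem desc_zero {k : Fin n} (hk : k.val = 0) (v : Fin n → ℕ) : Desc k v ↔ v k = 0 := by
  rw [Desc, if_pos hk]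

theorem desc_pos {k : Fin n} (hk : k.val ≠ 0) (v : Fin n → ℕ) :
    Desc k v ↔ v k < v (prevIdx k) := by
  rw [Desc, if_neg hk]

theorem Asc.zeroAct_eq {k : Fin n} {v : Fin n → ℕ} (h : Asc k v) : zeroAct k v = act k v := by
  refine if_pos ?_
  by_cases hk : k.val = 0
  · exact Or.inl hk
  · exact Or.inr ((asc_pos hk v).1 h)

theorem card_inversions_act {k : Fin n} (hk : k.val ≠ 0) {v : Fin n → ℕ}
    (h : v (prevIdx k) < v k) :
    (inversions (act k v)).card = (inversions v).card + 1 := by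
  have hp := prevIdx_val k
  -- Exchanging the positions `k - 1` and `k` preserves the order of every other pair.
  have key : inversions (act k v) = insert (prevIdx k, k) ((inversions v).map
      ((Equiv.swap (prevIdx k) k).prodCongr (Equiv.swap (prevIdx k) k)).toEmbedding) := by
    ext ⟨i, j⟩
    simp only [inversions, act_pos hk, Finset.mem_insert, Finset.mem_map_equiv, Finset.mem_filter,
      Finset.mem_univ, true_and, Function.comp, Prod.mk.injEq, Equiv.prodCongr_symm,
      Equiv.prodCongr_apply, Prod.map, Equiv.symm_swap]
    simp only [Equiv.swap_apply_def, Fin.lt_def]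
    split_ifs <;> grind
  rw [key, Finset.card_insert_of_notMem, Finset.card_map]
  simp only [inversions, Finset.mem_map_equiv, Finset.mem_filter, Finset.mem_univ, true_and,
    Equiv.prodCongr_symm, Equiv.prodCongr_apply, Prod.map, Equiv.symm_swap,
    Equiv.swap_apply_left, Equiv.swap_apply_right, Fin.lt_def]
  omega

theorem sum_act {k : Fin n} (hk : k.val ≠ 0) (v : Fin n → ℕ) :
    ∑ i, (act k v i : ℤ) = ∑ i, (v i : ℤ) := by
  rw [act_pos hk]
  exact Equiv.sum_comp (Equiv.swap (prevIdx k) k) fun i => (v i : ℤ)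

theorem level_act_pos {k : Fin n} (hk : k.val ≠ 0) {v : Fin n → ℕ}
    (h : v (prevIdx k) < v k) : level (act k v) = level v + 1 := by
  rw [level, level, sum_act hk, card_inversions_act hk h]
  push_cast
  ring

theorem act_act {k : Fin n} (hk : k.val ≠ 0) (v : Fin n → ℕ) : act k (act k v) = v := by
  ext i
  simp [act_pos hk]

theorem act_prevIdx {k : Fin n} (hk : k.val ≠ 0) (v : Fin n → ℕ) : act k v (prevIdx k) = v k := by
  simp [act_pos hk]

theorem act_self {k : Fin n} (hk : k.val ≠ 0) (v : Fin n → ℕ) : act k v k = v (prevIdx k) := by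
  simp [act_pos hk]

theorem act_eq_self {k : Fin n} (hk : k.val ≠ 0) {v : Fin n → ℕ} (h : v (prevIdx k) = v k) :
    act k v = v := by
  ext i
  rw [act_pos hk, Function.comp, Equiv.swap_apply_def]
  split_ifs with h1 h2
  · rw [h1, h]
  · rw [h2, h]
  · rfl

/-- Erasing the first entry `a` changes the level by `a - n` plus the number of entries `≥ a`. -/
theorem level_act_zero {k : Fin n} (hk : k.val = 0) (v : Fin n → ℕ) :
    level (act k v) = level v + v k - n + (Finset.univ.filter fun j => v k ≤ v j).card := by
  have hinv : inversions v = inversions (act k v) ∪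
      (Finset.univ.filter fun j => ¬ v k ≤ v j).image (fun j => (k, j)) := by
    ext ⟨i, j⟩
    simp only [inversions, act_zero hk, Function.update_apply, Finset.mem_union, Finset.mem_image,
      Finset.mem_filter, Finset.mem_univ, true_and, Prod.mk.injEq, not_le, Fin.lt_def,
      Fin.ext_iff]
    constructor
    · rintro ⟨h1, h2⟩
      by_cases hi : i.val = k.val
      · obtain rfl := Fin.ext hi
        right
        exact ⟨j, h2, rfl, rfl⟩
      · left
        rw [if_neg hi, if_neg (by omega)]
        exact ⟨h1, h2⟩
    · rintro (⟨h1, h2⟩ | ⟨j', h2, h3, h4⟩)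
      · refine ⟨h1, ?_⟩
        by_cases hi : i.val = k.val
        · rw [if_pos hi] at h2
          omega
        · rwa [if_neg hi, if_neg (by omega)] at h2
      · obtain rfl := Fin.ext h3
        obtain rfl := Fin.ext h4
        refine ⟨?_, h2⟩
        have : j' ≠ k := by rintro rfl; omega
        have := Fin.val_ne_of_ne this
        omega
  have hdisj : Disjoint (inversions (act k v))
      ((Finset.univ.filter fun j => ¬ v k ≤ v j).image (fun j => (k, j))) := by
    rw [Finset.disjoint_left]
    rintro ⟨i, j⟩ h1 h2
    simp only [inversions, act_zero hk, Finset.mem_image,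
      Finset.mem_filter, Finset.mem_univ, true_and, Prod.mk.injEq] at h1 h2
    obtain ⟨j', -, rfl, rfl⟩ := h2
    simp at h1
  have hcard : (inversions v).card = (inversions (act k v)).card +
      (Finset.univ.filter fun j => ¬ v k ≤ v j).card := by
    conv_lhs => rw [hinv]
    rw [Finset.card_union_of_disjoint hdisj, Finset.card_image_of_injective]
    exact fun a b h => (Prod.mk.inj h).2
  have hsplit := Finset.card_filter_add_card_filter_not (s := (Finset.univ : Finset (Fin n)))
    (fun j => v k ≤ v j)
  rw [Finset.card_univ, Fintype.card_fin] at hsplit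
  have hsum : ∑ i, (act k v i : ℤ) + v k = ∑ i, (v i : ℤ) := by
    rw [← Finset.add_sum_erase _ _ (Finset.mem_univ k),
      ← Finset.add_sum_erase _ (fun i => (v i : ℤ)) (Finset.mem_univ k), act_zero hk]
    rw [Finset.sum_congr rfl (g := fun i => (v i : ℤ))]
    · simp [add_comm]
    · intro i hi
      rw [Function.update_of_ne (Finset.ne_of_mem_erase hi)]
  simp only [level]
  omega

theorem image_entries_subset (v : Fin n → ℕ) (hv : IsRookVector v) (a : ℕ) :
    (Finset.univ.filter fun j => a ≤ v j).image v ⊆ Finset.Icc a n := by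
  intro b hb
  obtain ⟨j, hj, rfl⟩ := Finset.mem_image.1 hb
  exact Finset.mem_Icc.2 ⟨(Finset.mem_filter.1 hj).2, hv.1 j⟩

theorem card_image_entries (v : Fin n → ℕ) (hv : IsRookVector v) {a : ℕ} (ha : 0 < a) :
    ((Finset.univ.filter fun j => a ≤ v j).image v).card =
      (Finset.univ.filter fun j => a ≤ v j).card := by
  refine Finset.card_image_of_injOn fun i hi j _ h => hv.2 i j h ?_
  have := (Finset.mem_filter.1 (Finset.mem_coe.1 hi)).2
  omega

theorem Asc.level_act {k : Fin n} {v : Fin n → ℕ} (hv : IsRookVector v) (h : Asc k v) :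
    level (act k v) = level v + 1 := by
  by_cases hk : k.val = 0
  · obtain ⟨h0, hb⟩ := (asc_zero hk v).1 h
    have himg : (Finset.univ.filter fun j => v k ≤ v j).image v = Finset.Icc (v k) n := by
      refine Finset.Subset.antisymm (image_entries_subset v hv _) fun b hb' => ?_
      rw [Finset.mem_Icc] at hb'
      rcases hb'.1.eq_or_lt with rfl | hlt
      · exact Finset.mem_image.2 ⟨k, by simp, rfl⟩
      · obtain ⟨i, rfl⟩ := hb b hlt hb'.2
        exact Finset.mem_image.2 ⟨i, by simp [hlt.le], rfl⟩
    have hc := card_image_entries v hv h0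
    rw [himg, Nat.card_Icc] at hc
    have := hv.1 k
    rw [level_act_zero hk, ← hc]
    omega
  · exact level_act_pos hk ((asc_pos hk v).1 h)

theorem level_act_le {k : Fin n} {v : Fin n → ℕ} (hv : IsRookVector v) (h : ¬ Asc k v) :
    level (act k v) ≤ level v := by
  by_cases hk : k.val = 0
  · rcases Nat.eq_zero_or_pos (v k) with h0 | h0
    · rw [act_zero hk, ← h0, Function.update_eq_self]
    · rw [asc_zero hk] at h
      push Not at h
      obtain ⟨b, hb, hbn, hmiss⟩ := h h0
      have hlt : ((Finset.univ.filter fun j => v k ≤ v j).image v).card <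
          (Finset.Icc (v k) n).card := by
        refine Finset.card_lt_card ((Finset.ssubset_iff_of_subset
          (image_entries_subset v hv _)).2 ⟨b, Finset.mem_Icc.2 ⟨hb.le, hbn⟩, fun hb' => ?_⟩)
        obtain ⟨j, -, hj⟩ := Finset.mem_image.1 hb'
        exact hmiss j hj
      rw [card_image_entries v hv h0, Nat.card_Icc] at hlt
      rw [level_act_zero hk]
      omega
  · rw [asc_pos hk, not_lt] at h
    rcases h.eq_or_lt with h | h
    · rw [act_eq_self hk h.symm]
    · have := level_act_pos hk (v := act k v) (by rwa [act_prevIdx hk, act_self hk])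
      rw [act_act hk] at this
      omega

theorem level_zeroAct_le {k : Fin n} {v : Fin n → ℕ} (hv : IsRookVector v) (h : ¬ Asc k v) :
    level (zeroAct k v) ≤ level v := by
  unfold zeroAct
  split_ifs
  exacts [level_act_le hv h, le_rfl]

/-! ### Predecessors -/

theorem Asc.desc_act {k : Fin n} {v : Fin n → ℕ} (h : Asc k v) : Desc k (act k v) := by
  by_cases hk : k.val = 0
  · rw [desc_zero hk, act_zero hk, Function.update_self]
  · rw [desc_pos hk, act_self hk, act_prevIdx hk]
    exact (asc_pos hk v).1 h

/-- The predecessor of a vector along a letter is unique: along `0`, the erased entry is the largest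
missing value. -/
theorem Asc.act_injective {k : Fin n} {v w : Fin n → ℕ} (hv : IsRookVector v)
    (hw : IsRookVector w) (h : Asc k v) (h' : Asc k w) (e : act k v = act k w) : v = w := by
  by_cases hk : k.val = 0
  · rw [act_zero hk, act_zero hk] at e
    have hne : ∀ i, i ≠ k → v i = w i := fun i hi => by
      simpa [hi] using congrFun e i
    rw [asc_zero hk] at h h'
    have hnlt : ∀ {v w : Fin n → ℕ}, IsRookVector w → (∀ i, i ≠ k → v i = w i) → 0 < w k →
        (∀ b, v k < b → b ≤ n → ∃ i, v i = b) → ¬ v k < w k := by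
      intro v w hw hne h0 hb hlt
      obtain ⟨i, hi⟩ := hb _ hlt (hw.1 k)
      have hik : i ≠ k := by rintro rfl; omega
      exact hik (hw.2 i k ((hne i hik).symm.trans hi) (by rw [← hne i hik, hi]; omega))
    have h1 := hnlt hw hne h'.1 h.2
    have h2 := hnlt hv (fun i hi => (hne i hi).symm) h.1 h'.2
    funext i
    by_cases hi : i = k
    · subst hi
      omega
    · exact hne i hi
  · rw [← act_act hk v, e, act_act hk]

theorem Desc.exists_pred {k : Fin n} {v : Fin n → ℕ} (hv : IsRookVector v) (h : Desc k v) :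
    ∃ u, IsRookVector u ∧ Asc k u ∧ act k u = v := by
  by_cases hk : k.val = 0
  · rw [desc_zero hk] at h
    -- Some value is missing, since the `n` positions include one with the entry `0`.
    have hne : (Finset.Icc 1 n \ Finset.univ.image v).Nonempty := by
      rw [Finset.sdiff_nonempty]
      intro hsub
      have hsub' : Finset.Icc 0 n ⊆ Finset.univ.image v := by
        intro b hb
        rcases Nat.eq_zero_or_pos b with rfl | hb0
        · exact Finset.mem_image.2 ⟨k, Finset.mem_univ _, h⟩
        · exact hsub (Finset.mem_Icc.2 ⟨hb0, (Finset.mem_Icc.1 hb).2⟩)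
      have h1 := (Finset.card_le_card hsub').trans Finset.card_image_le
      rw [Nat.card_Icc, Finset.card_univ, Fintype.card_fin] at h1
      omega
    obtain ⟨a, ha, hmax⟩ := Finset.exists_max_image _ id hne
    simp only [Finset.mem_sdiff, Finset.mem_Icc, Finset.mem_image, Finset.mem_univ, true_and,
      not_exists, id] at ha hmax
    refine ⟨Function.update v k a, ⟨fun i => ?_, fun i j => ?_⟩, ?_, ?_⟩
    · rw [Function.update_apply]
      split_ifs
      exacts [ha.1.2, hv.1 i]
    · simp only [Function.update_apply]
      split_ifs with h1 h2 h2
      · exact fun _ _ => h1.trans h2.symm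
      · exact fun h => absurd h.symm (ha.2 j)
      · exact fun h => absurd h (ha.2 i)
      · exact hv.2 i j
    · rw [asc_zero hk, Function.update_self]
      refine ⟨ha.1.1, fun b hab hbn => ?_⟩
      by_contra hmiss
      push Not at hmiss
      refine absurd (hmax b ⟨⟨by omega, hbn⟩, fun i hi => hmiss i ?_⟩) (by omega)
      rw [Function.update_of_ne, hi]
      rintro rfl
      omega
    · rw [act_zero hk, Function.update_idem, ← h, Function.update_eq_self]
  · rw [desc_pos hk] at h
    refine ⟨act k v, hv.act k, ?_, act_act hk v⟩
    rwa [asc_pos hk, act_self hk, act_prevIdx hk]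

/-- A rook vector without descents is strictly increasing with positive entries, hence it is
`(1, …, n)`. -/
theorem eq_idVector_of_forall_not_desc {v : Fin n → ℕ} (hv : IsRookVector v)
    (h : ∀ k, ¬ Desc k v) : v = idVector n := by
  have hpos : ∀ m (hm : m < n), m + 1 ≤ v ⟨m, hm⟩ := by
    intro m
    induction m with
    | zero =>
      intro hm
      have := h ⟨0, hm⟩
      rw [desc_zero rfl] at this
      omega
    | succ m ih =>
      intro hm
      have h1 := h ⟨m + 1, hm⟩
      rw [desc_pos (Nat.succ_ne_zero m)] at h1
      have h2 : prevIdx ⟨m + 1, hm⟩ = (⟨m, by omega⟩ : Fin n) := Fin.ext rfl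
      rw [h2] at h1
      have h3 := ih (by omega)
      have h4 : v ⟨m, by omega⟩ ≠ v ⟨m + 1, hm⟩ := fun e => by
        have := Fin.val_eq_of_eq (hv.2 _ _ e (by omega))
        simp at this
      omega
  have hgap : ∀ d m (hm : m < n), m + d + 1 = n → v ⟨m, hm⟩ ≤ m + 1 := by
    intro d
    induction d with
    | zero =>
      intro m hm e
      have := hv.1 ⟨m, hm⟩
      omega
    | succ d ih =>
      intro m hm e
      have h1 := h ⟨m + 1, by omega⟩
      rw [desc_pos (Nat.succ_ne_zero m)] at h1
      have h2 : prevIdx ⟨m + 1, by omega⟩ = (⟨m, by omega⟩ : Fin n) := Fin.ext rfl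
      rw [h2] at h1
      have h3 := ih (m + 1) (by omega) (by omega)
      have h5 := hpos m hm
      have h4 : v ⟨m, by omega⟩ ≠ v ⟨m + 1, by omega⟩ := fun e => by
        have := Fin.val_eq_of_eq (hv.2 _ _ e (by omega))
        simp at this
      omega
  funext i
  have h1 := hpos i i.isLt
  have h2 := hgap (n - i - 1) i i.isLt (by omega)
  simp only [idVector]
  simp only [Fin.eta] at h1 h2
  omega

/-! ### The braid theorem for ascending words -/

/-- The word `w` leads from the identity to `v`, each letter going one level up. -/
inductive AscWord : FreeMonoid (Fin n) → (Fin n → ℕ) → Prop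
  | one : AscWord 1 (idVector n)
  | snoc {w : FreeMonoid (Fin n)} {v : Fin n → ℕ} (k : Fin n) (hw : AscWord w v) (h : Asc k v) :
      AscWord (w * FreeMonoid.of k) (act k v)

theorem AscWord.isRookVector {w : FreeMonoid (Fin n)} {v : Fin n → ℕ} (h : AscWord w v) :
    IsRookVector v := by
  induction h with
  | one => exact isRookVector_idVector n
  | snoc k _ _ ih => exact ih.act k

theorem AscWord.level_eq {w : FreeMonoid (Fin n)} {v : Fin n → ℕ} (h : AscWord w v) :
    level v = level (idVector n) + w.length := by
  induction h with
  | one => simp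
  | snoc k hw h ih =>
    rw [h.level_act hw.isRookVector, ih, FreeMonoid.length_mul, FreeMonoid.length_of]
    push_cast
    ring

theorem AscWord.eq_one_or_snoc {w : FreeMonoid (Fin n)} {v : Fin n → ℕ} (h : AscWord w v) :
    w = 1 ∨ ∃ k w' u, w = w' * FreeMonoid.of k ∧ AscWord w' u ∧ Asc k u ∧ act k u = v := by
  cases h with
  | one => exact Or.inl rfl
  | snoc k hw h => exact Or.inr ⟨k, _, _, rfl, hw, h, rfl⟩

theorem neg_sq_le_level {v : Fin n → ℕ} (hv : IsRookVector v) : -(n * n : ℤ) ≤ level v := by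
  have h : ∑ i, (v i : ℤ) ≤ n * n := by
    have := Finset.sum_le_card_nsmul Finset.univ (fun i => (v i : ℤ)) n
      fun i _ => by exact_mod_cast hv.1 i
    simpa using this
  simp only [level]
  omega

theorem exists_ascWord {v : Fin n → ℕ} (hv : IsRookVector v) : ∃ w, AscWord w v := by
  induction hN : (level v + n * n).toNat using Nat.strong_induction_on generalizing v with
  | _ N ih =>
    by_cases h : ∃ k, Desc k v
    · obtain ⟨k, hk⟩ := h
      obtain ⟨u, hu, hasc, rfl⟩ := hk.exists_pred hv
      have h1 := hasc.level_act hu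
      have h2 := neg_sq_le_level hu
      obtain ⟨w, hw⟩ := ih _ (by omega) hu rfl
      exact ⟨_, hw.snoc k hasc⟩
    · push Not at h
      rw [eq_idVector_of_forall_not_desc hv h]
      exact ⟨1, .one⟩

/-- The letters `i` and `j` commute. -/
def Far (i j : Fin n) : Prop := i.val + 2 ≤ j.val ∨ j.val + 2 ≤ i.val

theorem Far.act_comm {i j : Fin n} (h : Far i j) (v : Fin n → ℕ) :
    act i (act j v) = act j (act i v) := by
  have hi := prevIdx_val i
  have hj := prevIdx_val j
  unfold Far at h
  funext x
  simp only [act]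
  split_ifs with h1 h2 h2 <;>
    simp only [Function.update_apply, Function.comp, Equiv.swap_apply_def] <;>
    split_ifs <;> grind

theorem Far.act_apply {i j x : Fin n} (h : Far i j) (v : Fin n → ℕ)
    (hx : x = i ∨ x = prevIdx i) : act j v x = v x := by
  have hi := prevIdx_val i
  have hj := prevIdx_val j
  unfold Far at h
  simp only [act]
  split_ifs with h1
  · rw [Function.update_of_ne]
    rintro rfl
    rcases hx with rfl | hx
    · omega
    · rw [Fin.ext_iff] at hx
      omega
  · rw [Function.comp, Equiv.swap_apply_of_ne_of_ne] <;>
      · rcases hx with rfl | rfl <;> rw [ne_eq, Fin.ext_iff] <;> omega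

theorem Far.asc_act {i j : Fin n} (h : Far i j) (v : Fin n → ℕ) :
    Asc i (act j v) ↔ Asc i v := by
  by_cases hi : i.val = 0
  · rw [asc_zero hi, asc_zero hi, h.act_apply v (Or.inl rfl)]
    have hj : j.val ≠ 0 := by
      unfold Far at h
      omega
    -- Exchanging two positions preserves the set of entries.
    have : ∀ b, (∃ x, act j v x = b) ↔ ∃ x, v x = b := fun b => by
      rw [act_pos hj]
      exact (Equiv.swap (prevIdx j) j).exists_congr_left.trans (by simp)
    simp only [this]
  · rw [asc_pos hi, asc_pos hi, h.act_apply v (Or.inl rfl), h.act_apply v (Or.inr rfl)]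

theorem Far.desc_act {i j : Fin n} (h : Far i j) (v : Fin n → ℕ) :
    Desc i (act j v) ↔ Desc i v := by
  unfold Desc
  rw [h.act_apply v (Or.inl rfl), h.act_apply v (Or.inr rfl)]

theorem Far.symm {i j : Fin n} (h : Far i j) : Far j i := Or.symm h

/-- If two commuting letters are descents, they can be undone in either order. -/
theorem Far.exists_diamond {i j : Fin n} (h : Far i j) {v : Fin n → ℕ} (hv : IsRookVector v)
    (hi : Desc i v) (hj : Desc j v) :
    ∃ u, IsRookVector u ∧ Asc i u ∧ Asc j (act i u) ∧ Asc j u ∧ Asc i (act j u) ∧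
      act i (act j u) = v ∧ act j (act i u) = v := by
  obtain ⟨w, hw, hiw, rfl⟩ := hi.exists_pred hv
  obtain ⟨u, hu, hju, rfl⟩ := ((h.symm.desc_act w).1 hj).exists_pred hw
  exact ⟨u, hu, (h.asc_act u).1 hiw, (h.symm.asc_act u).2 hju, hju, hiw, rfl,
    h.symm.act_comm u⟩

theorem Desc.asc_act {k : Fin n} (hk : k.val ≠ 0) {v : Fin n → ℕ} (h : Desc k v) :
    Asc k (act k v) := by
  rwa [asc_pos hk, act_self hk, act_prevIdx hk, ← desc_pos hk]

theorem act_braid {i j : Fin n} (hi : i.val ≠ 0) (hij : j.val = i.val + 1) (v : Fin n → ℕ) :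
    act i (act j (act i v)) = act j (act i (act j v)) := by
  have hp := prevIdx_val i
  have hpj : prevIdx j = i := Fin.ext (by rw [prevIdx_val]; omega)
  have h1 : prevIdx i ≠ i := by rw [ne_eq, Fin.ext_iff]; omega
  have h2 : prevIdx i ≠ j := by rw [ne_eq, Fin.ext_iff]; omega
  have h3 : i ≠ j := by rw [ne_eq, Fin.ext_iff]; omega
  have e1 := Equiv.swap_mul_swap_mul_swap h3.symm h2.symm
  have e2 := Equiv.swap_mul_swap_mul_swap h1 h2
  rw [Equiv.swap_comm j i, Equiv.swap_comm i (prevIdx i)] at e1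
  simp only [act_pos hi, act_pos (k := j) (by omega), hpj, Function.comp_assoc,
    ← Equiv.Perm.coe_mul]
  rw [e1, e2, Equiv.swap_comm]

/-- If `i` and `i + 1` are descents, sorting the three entries concerned leads three levels down in
two ways. -/
theorem exists_hexagon {i j : Fin n} (hi0 : 1 ≤ i.val) (hij : j.val = i.val + 1)
    {v : Fin n → ℕ} (hv : IsRookVector v) (hi : Desc i v) (hj : Desc j v) :
    ∃ u, IsRookVector u ∧
      (Asc i u ∧ Asc j (act i u) ∧ Asc i (act j (act i u)) ∧ act i (act j (act i u)) = v) ∧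
      (Asc j u ∧ Asc i (act j u) ∧ Asc j (act i (act j u)) ∧ act j (act i (act j u)) = v) := by
  have hi' : i.val ≠ 0 := by omega
  have hj' : j.val ≠ 0 := by omega
  have hp := prevIdx_val i
  have hpj : prevIdx j = i := Fin.ext (by rw [prevIdx_val]; omega)
  have h2 : prevIdx i ≠ j := by rw [ne_eq, Fin.ext_iff]; omega
  have h3 : i ≠ j := by rw [ne_eq, Fin.ext_iff]; omega
  have h1 : prevIdx i ≠ i := by rw [ne_eq, Fin.ext_iff]; omega
  have eij : ∀ w, act i w j = w j := fun w => by
    rw [act_pos hi', Function.comp, Equiv.swap_apply_of_ne_of_ne h2.symm h3.symm]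
  have eji : ∀ w, act j w (prevIdx i) = w (prevIdx i) := fun w => by
    rw [act_pos hj', hpj, Function.comp, Equiv.swap_apply_of_ne_of_ne h1 h2]
  have ei : ∀ w, act i w i = w (prevIdx i) := act_self hi'
  have ep : ∀ w, act i w (prevIdx i) = w i := act_prevIdx hi'
  have ej : ∀ w, act j w j = w i := fun w => by rw [act_self hj', hpj]
  have ejp : ∀ w, act j w i = w j := fun w => by
    have := act_prevIdx hj' w
    rwa [hpj] at this
  have di := (desc_pos hi' v).1 hi
  have dj := (desc_pos hj' v).1 hj
  rw [hpj] at dj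
  refine ⟨act i (act j (act i v)), ((hv.act i).act j).act i, ?_, ?_⟩
  · refine ⟨Desc.asc_act hi' ?_, ?_, ?_, ?_⟩
    · rw [desc_pos hi', ejp, eij, eji, ep]
      exact dj
    · rw [act_act hi']
      refine Desc.asc_act hj' ?_
      rw [desc_pos hj', hpj, eij, ei]
      exact dj.trans di
    · rw [act_act hi', act_act hj']
      exact hi.asc_act hi'
    · rw [act_act hi', act_act hj', act_act hi']
  · rw [act_braid hi' hij]
    refine ⟨Desc.asc_act hj' ?_, ?_, ?_, ?_⟩
    · rw [desc_pos hj', hpj, eij, ei, ej, eji]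
      exact di
    · rw [act_act hj']
      refine Desc.asc_act hi' ?_
      rw [desc_pos hi', ejp, eji]
      exact dj.trans di
    · rw [act_act hj', act_act hi']
      exact hj.asc_act hj'
    · rw [act_act hj', act_act hi', act_act hj']

/-- Two ascending words for the same vector are congruent by braid relations. -/
theorem AscWord.braidCon {u w : FreeMonoid (Fin n)} {v : Fin n → ℕ} (hu : AscWord u v)
    (hw : AscWord w v) : braidCon n u w := by
  induction hN : u.length using Nat.strong_induction_on generalizing u w v with
  | _ N ih =>
  have hlen : u.length = w.length := by
    have h1 := hu.level_eq
    have h2 := hw.level_eq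
    omega
  have hv := hu.isRookVector
  rcases hu.eq_one_or_snoc with rfl | ⟨i, u', x, rfl, hu', hix, hxv⟩
  · rw [FreeMonoid.length_one, eq_comm, FreeMonoid.length_eq_zero] at hlen
    rw [hlen]
    exact (_root_.braidCon n).refl _
  rcases hw.eq_one_or_snoc with rfl | ⟨j, w', y, rfl, hw', hjy, hyv⟩
  · simp at hlen
  simp only [FreeMonoid.length_mul, FreeMonoid.length_of] at hlen hN
  have hcon : ∀ {a b}, BraidRel n a b → _root_.braidCon n a b := fun h => ConGen.Rel.of _ _ h
  have hx := hu'.isRookVector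
  have hy := hw'.isRookVector
  have hdi : Desc i v := hxv ▸ hix.desc_act
  have hdj : Desc j v := hyv ▸ hjy.desc_act
  -- Two words for the predecessor along one letter are congruent, by induction.
  have stepx : ∀ {c}, AscWord c x → _root_.braidCon n u' c := fun hc => ih _ (by omega) hu' hc rfl
  have stepy : ∀ {c}, AscWord c y → _root_.braidCon n c w' := fun hc =>
    (_root_.braidCon n).symm (ih _ (by omega) hw' hc rfl)
  have hexagon : ∀ {i j : Fin n} {u' w' : FreeMonoid (Fin n)} {x y : Fin n → ℕ},
      1 ≤ i.val → j.val = i.val + 1 → Asc i x → act i x = v → IsRookVector x → IsRookVector y →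
      Asc j y → act j y = v → (∀ {c}, AscWord c x → _root_.braidCon n u' c) →
      (∀ {c}, AscWord c y → _root_.braidCon n c w') →
      _root_.braidCon n (u' * FreeMonoid.of i) (w' * FreeMonoid.of j) := by
    intro i j u' w' x y hi0 hij hix hxv hx hy hjy hyv stepx stepy
    obtain ⟨z, hz, ⟨a1, a2, a3, a4⟩, b1, b2, b3, b4⟩ :=
      exists_hexagon hi0 hij hv (hxv ▸ hix.desc_act) (hyv ▸ hjy.desc_act)
    obtain ⟨c, hc⟩ := exists_ascWord hz
    have ex := a3.act_injective ((hz.act i).act j) hx hix (a4.trans hxv.symm)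
    have ey := b3.act_injective ((hz.act j).act i) hy hjy (b4.trans hyv.symm)
    have h1 := stepx (ex ▸ (hc.snoc i a1).snoc j a2)
    have h2 := stepy (ey ▸ (hc.snoc j b1).snoc i b2)
    have h3 := (_root_.braidCon n).mul ((_root_.braidCon n).refl c) (hcon (.braid i j hi0 hij))
    refine (_root_.braidCon n).trans ((_root_.braidCon n).mul h1 ((_root_.braidCon n).refl _))
      ((_root_.braidCon n).trans ?_
        ((_root_.braidCon n).mul h2 ((_root_.braidCon n).refl _)))
    simpa only [mul_assoc] using h3
  by_cases hij : i = j
  · subst hij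
    have e := hix.act_injective hx hy hjy (hxv.trans hyv.symm)
    subst e
    exact (_root_.braidCon n).mul (stepx hw') ((_root_.braidCon n).refl _)
  by_cases hfar : Far i j
  · obtain ⟨z, hz, a1, a2, b1, b2, b3, a3⟩ := hfar.exists_diamond hv hdi hdj
    obtain ⟨c, hc⟩ := exists_ascWord hz
    have ex := b2.act_injective (hz.act j) hx hix (b3.trans hxv.symm)
    have ey := a2.act_injective (hz.act i) hy hjy (a3.trans hyv.symm)
    have h1 := stepx (ex ▸ hc.snoc j b1)
    have h2 := stepy (ey ▸ hc.snoc i a1)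
    have h3 := (_root_.braidCon n).mul ((_root_.braidCon n).refl c) (hcon (.comm j i hfar.symm))
    refine (_root_.braidCon n).trans ((_root_.braidCon n).mul h1 ((_root_.braidCon n).refl _))
      ((_root_.braidCon n).trans ?_
        ((_root_.braidCon n).mul h2 ((_root_.braidCon n).refl _)))
    simpa only [mul_assoc] using h3
  -- The letters `0` and `1` are never descents of the same vector.
  have h01 : ∀ {i j : Fin n}, Desc i v → Desc j v → i.val = 0 → j.val ≠ 1 := by
    intro i j hi hj hi0 hj1
    rw [desc_zero hi0] at hi
    rw [desc_pos (by omega), show prevIdx j = i from Fin.ext (by rw [prevIdx_val]; omega)] at hj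
    omega
  have hval : i.val ≠ j.val := fun h => hij (Fin.ext h)
  have hi1 := h01 hdi hdj
  have hj1 := h01 hdj hdi
  unfold Far at hfar
  rcases (by omega : j.val = i.val + 1 ∨ i.val = j.val + 1) with h | h
  · exact hexagon (by omega) h hix hxv hx hy hjy hyv stepx stepy
  · exact (_root_.braidCon n).symm (hexagon (by omega) h hjy hyv hy hx hix hxv
      (fun hc => (_root_.braidCon n).symm (stepy hc))
      (fun hc => (_root_.braidCon n).symm (stepx hc)))

/-! ### Ascending words and the two right actions -/

/-- The result of applying the letters of `w` to `v` from left to right, where the letter `k` acts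
by `f k`. -/
def run (f : Fin n → (Fin n → ℕ) → Fin n → ℕ) (v : Fin n → ℕ) (w : FreeMonoid (Fin n)) :
    Fin n → ℕ :=
  w.toList.foldl (fun v k => f k v) v

theorem run_one (f : Fin n → (Fin n → ℕ) → Fin n → ℕ) (v : Fin n → ℕ) : run f v 1 = v := rfl

theorem run_mul_of (f : Fin n → (Fin n → ℕ) → Fin n → ℕ) (v : Fin n → ℕ)
    (w : FreeMonoid (Fin n)) (k : Fin n) :
    run f v (w * FreeMonoid.of k) = f k (run f v w) := by
  simp [run, FreeMonoid.toList_mul]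

theorem run_of_mul (f : Fin n → (Fin n → ℕ) → Fin n → ℕ) (v : Fin n → ℕ)
    (w : FreeMonoid (Fin n)) (k : Fin n) :
    run f v (FreeMonoid.of k * w) = run f (f k v) w := by
  simp [run, FreeMonoid.toList_mul]

theorem snoc_induction {P : FreeMonoid (Fin n) → Prop} (w : FreeMonoid (Fin n)) (one : P 1)
    (snoc : ∀ w k, P w → P (w * FreeMonoid.of k)) : P w :=
  List.reverseRecOn (motive := P) w one snoc

/-- An action of the letters which agrees with `act` on ascents, and does not raise the level
otherwise. -/
structure IsAscAction (f : Fin n → (Fin n → ℕ) → Fin n → ℕ) : Prop where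
  isRookVector : ∀ k v, IsRookVector v → IsRookVector (f k v)
  eq_act : ∀ k v, Asc k v → f k v = act k v
  level_le : ∀ k v, IsRookVector v → ¬ Asc k v → level (f k v) ≤ level v

theorem isAscAction_act : IsAscAction (act (n := n)) :=
  ⟨fun k _ h => h.act k, fun _ _ _ => rfl, fun _ _ => level_act_le⟩

theorem isAscAction_zeroAct : IsAscAction (zeroAct (n := n)) :=
  ⟨fun k _ h => h.zeroAct k, fun _ _ => Asc.zeroAct_eq, fun _ _ => level_zeroAct_le⟩

namespace IsAscAction

variable {f : Fin n → (Fin n → ℕ) → Fin n → ℕ}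

theorem isRookVector_run (hf : IsAscAction f) {v : Fin n → ℕ} (hv : IsRookVector v)
    (w : FreeMonoid (Fin n)) :
    IsRookVector (run f v w) := by
  induction w using snoc_induction with
  | one => exact hv
  | snoc w k ih =>
    rw [run_mul_of]
    exact hf.isRookVector k _ ih

theorem run_eq (hf : IsAscAction f) {w : FreeMonoid (Fin n)} {v : Fin n → ℕ} (h : AscWord w v) :
    run f (idVector n) w = v := by
  induction h with
  | one => rfl
  | snoc k _ h ih => rw [run_mul_of, ih, hf.eq_act k _ h]

theorem level_run_le (hf : IsAscAction f) (w : FreeMonoid (Fin n)) :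
    level (run f (idVector n) w) ≤ level (idVector n) + w.length := by
  induction w using snoc_induction with
  | one => simp [run_one]
  | snoc w k ih =>
    have hv := hf.isRookVector_run (isRookVector_idVector n) w
    rw [run_mul_of, FreeMonoid.length_mul, FreeMonoid.length_of]
    push_cast
    by_cases h : Asc k (run f (idVector n) w)
    · rw [hf.eq_act k _ h, h.level_act hv]
      omega
    · have := hf.level_le k _ hv h
      omega

/-- A word which raises the level by its length does so letter by letter. -/
theorem ascWord_of_level_eq (hf : IsAscAction f) (w : FreeMonoid (Fin n))
    (h : level (run f (idVector n) w) = level (idVector n) + w.length) :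
    AscWord w (run f (idVector n) w) := by
  induction w using snoc_induction with
  | one => exact .one
  | snoc w k ih =>
    have hv := hf.isRookVector_run (isRookVector_idVector n) w
    have hle := hf.level_run_le w
    rw [run_mul_of, FreeMonoid.length_mul, FreeMonoid.length_of] at h
    push_cast at h
    rw [run_mul_of]
    by_cases hk : Asc k (run f (idVector n) w)
    · rw [hf.eq_act k _ hk] at h ⊢
      rw [hk.level_act hv] at h
      exact (ih (by omega)).snoc k hk
    · have := hf.level_le k _ hv hk
      omega

/-- In a monoid generated by letters whose elements are determined by the vector `run f`, the
reduced words are the ascending words. -/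
theorem isReducedWord_iff (hf : IsAscAction f) {M : Type*} [Monoid M] {g : Fin n → M}
    (hg : ∀ u w : FreeMonoid (Fin n), FreeMonoid.lift g u = FreeMonoid.lift g w ↔
      run f (idVector n) u = run f (idVector n) w) (w : FreeMonoid (Fin n)) :
    IsReducedWord g w ↔ AscWord w (run f (idVector n) w) := by
  constructor
  · rintro ⟨-, hmin⟩
    obtain ⟨u, hu⟩ := exists_ascWord (hf.isRookVector_run (isRookVector_idVector n) w)
    have h1 := hmin u ((hg u w).2 (hf.run_eq hu))
    have h2 := hu.level_eq
    have h3 := hf.level_run_le w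
    exact hf.ascWord_of_level_eq w (by omega)
  · intro h
    refine ⟨rfl, fun u hu => ?_⟩
    have h1 := hf.level_run_le u
    rw [(hg u w).1 hu, h.level_eq] at h1
    omega

theorem braidCon_of_isReducedWordFor (hf : IsAscAction f) {M : Type*} [Monoid M] {g : Fin n → M}
    (hg : ∀ u w : FreeMonoid (Fin n), FreeMonoid.lift g u = FreeMonoid.lift g w ↔
      run f (idVector n) u = run f (idVector n) w) {x : M} {u w : FreeMonoid (Fin n)}
    (hu : IsReducedWordFor g u x) (hw : IsReducedWordFor g w x) : braidCon n u w := by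
  obtain rfl := hu.1
  have e := hw.1
  have h1 := (hf.isReducedWord_iff hg u).1 hu
  have h2 := (hf.isReducedWord_iff hg w).1 (by rwa [IsReducedWord, e])
  rw [(hg w u).1 e] at h2
  exact h1.braidCon h2

end IsAscAction

theorem AscWord.wordPrefix {w : FreeMonoid (Fin n)} {v : Fin n → ℕ} (h : AscWord w v) :
    ∀ k ≤ w.length, ∃ u, AscWord (wordPrefix w k) u := by
  induction h with
  | one =>
    intro k _
    refine ⟨idVector n, ?_⟩
    rw [show _root_.wordPrefix (1 : FreeMonoid (Fin n)) k = 1 from List.take_nil]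
    exact .one
  | @snoc w v l hw h ih =>
    intro k hk
    rw [FreeMonoid.length_mul, FreeMonoid.length_of] at hk
    rcases hk.eq_or_lt with rfl | hlt
    · refine ⟨act l v, ?_⟩
      have : _root_.wordPrefix (w * FreeMonoid.of l) (w.length + 1) = w * FreeMonoid.of l :=
        List.take_of_length_le (by simp [FreeMonoid.length, FreeMonoid.toList_mul])
      rw [this]
      exact hw.snoc l h
    · obtain ⟨u, hu⟩ := ih k (by omega)
      refine ⟨u, ?_⟩
      have : _root_.wordPrefix (w * FreeMonoid.of l) k = _root_.wordPrefix w k := by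
        unfold _root_.wordPrefix
        rw [FreeMonoid.toList_mul, List.take_append_of_le_length]
        exact Nat.lt_succ_iff.1 hlt
      rwa [this]

theorem length_wordPrefix {w : FreeMonoid (Fin n)} {k : ℕ} (hk : k ≤ w.length) :
    (wordPrefix w k).length = k :=
  List.length_take_of_le hk

/-! ### The commuting left action on values -/

/-- The value `k + 1` occurs in `v`, and `k` does not occur to the right of it. -/
def LeftAsc (k : ℕ) (v : Fin n → ℕ) : Prop :=
  ∃ i, v i = k + 1 ∧ ∀ j, v j = k → j < i

open Classical in
/-- The operator on the values of a rook vector obtained from `zeroAct` by exchanging rows and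
columns: `0` erases the value `1`; `k ≥ 1` exchanges the values `k` and `k + 1` if `k + 1` occurs,
and `k` does not occur to the right of it. -/
noncomputable def leftAct (k : ℕ) (v : Fin n → ℕ) : Fin n → ℕ :=
  if k = 0 then fun i => if v i = 1 then 0 else v i
  else if LeftAsc k v then fun i => Equiv.swap k (k + 1) (v i)
  else v

theorem leftAct_idVector (k : Fin n) : leftAct k.val (idVector n) = zeroAct k (idVector n) := by
  have hp := prevIdx_val k
  have hd : k.val = 0 ∨ idVector n (prevIdx k) < idVector n k := by
    simp only [idVector]
    omega
  rw [zeroAct, if_pos hd]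
  funext i
  by_cases hk : k.val = 0
  · rw [leftAct, if_pos hk, act_zero hk, Function.update_apply]
    have hi : idVector n i = 1 ↔ i = k := by
      simp only [idVector, Fin.ext_iff]
      omega
    simp only [hi]
  · have hD : LeftAsc k.val (idVector n) :=
      ⟨k, rfl, fun j hj => by simp only [idVector] at hj; rw [Fin.lt_def]; omega⟩
    rw [leftAct, if_neg hk, if_pos hD, act_pos hk]
    simp only [Function.comp, idVector, Equiv.swap_apply_def, Fin.ext_iff]
    split_ifs <;> omega

/-- Sorting two adjacent entries into decreasing order preserves `LeftAsc k`, unless these entries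
are `k` and `k + 1`. -/
theorem leftAsc_act_iff {v : Fin n → ℕ} (hv : IsRookVector v) (k : ℕ) {l : Fin n} (hl : l.val ≠ 0)
    (hlt : v (prevIdx l) < v l) :
    LeftAsc k (act l v) ↔ LeftAsc k v ∧ ¬ (v (prevIdx l) = k ∧ v l = k + 1) := by
  have hp := prevIdx_val l
  have hmono : ∀ i j, i < j → ¬ (i = prevIdx l ∧ j = l) →
      Equiv.swap (prevIdx l) l i < Equiv.swap (prevIdx l) l j := by
    intro i j
    simp only [Equiv.swap_apply_def, Fin.lt_def]
    split_ifs <;> grind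
  rw [act_pos hl]
  constructor
  · rintro ⟨i, hi, hmax⟩
    refine ⟨⟨Equiv.swap (prevIdx l) l i, hi, fun j hj => ?_⟩, fun ⟨h1, h2⟩ => ?_⟩
    · have h := hmono _ _ (hmax (Equiv.swap (prevIdx l) l j) (by simpa using hj)) ?_
      · simpa using h
      · rintro ⟨h1, rfl⟩
        rw [Equiv.swap_apply_eq_iff, Equiv.swap_apply_left] at h1
        subst h1
        simp only [Function.comp, Equiv.swap_apply_right] at hi
        omega
    · have h3 := hv.2 _ _ (hi.trans h2.symm) (by
        simp only [Function.comp] at hi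
        omega)
      rw [Equiv.swap_apply_eq_iff, Equiv.swap_apply_right] at h3
      subst h3
      have h4 := hmax l (by simpa using h1)
      rw [Fin.lt_def] at h4
      omega
  · rintro ⟨⟨i, hi, hmax⟩, hne⟩
    refine ⟨Equiv.swap (prevIdx l) l i, by simpa using hi, fun j hj => ?_⟩
    have h := hmono _ _ (hmax _ hj) ?_
    · simpa using h
    · rintro ⟨h1, rfl⟩
      exact hne ⟨h1 ▸ hj, hi⟩

theorem leftAct_zeroAct_of_eq_zero {v : Fin n → ℕ} (hv : IsRookVector v) {k : ℕ} (hk : k ≠ 0)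
    {l : Fin n} (hl : l.val = 0) : leftAct k (zeroAct l v) = zeroAct l (leftAct k v) := by
  have hz : ∀ w : Fin n → ℕ, zeroAct l w = Function.update w l 0 := fun w => by
    rw [zeroAct, if_pos (Or.inl hl), act_zero hl]
  have hσ : Equiv.swap k (k + 1) 0 = 0 :=
    Equiv.swap_apply_of_ne_of_ne (Ne.symm hk) (Nat.succ_ne_zero k).symm
  rw [hz, hz, leftAct, leftAct, if_neg hk, if_neg hk]
  have hup : ∀ {i b}, b ≠ 0 → Function.update v l 0 i = b → i ≠ l ∧ v i = b := by
    intro i b hb h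
    rcases eq_or_ne i l with rfl | hi
    · rw [Function.update_self] at h
      exact absurd h.symm hb
    · rw [Function.update_of_ne hi] at h
      exact ⟨hi, h⟩
  by_cases hD : LeftAsc k v
  · rw [if_pos hD]
    split_ifs with hD'
    · funext i
      rcases eq_or_ne i l with rfl | hi
      · simp [hσ]
      · simp [hi]
    · -- The entry `k + 1` comes first, hence `k` does not occur: erasing `k + 1` leaves neither.
      obtain ⟨i, hi, hmax⟩ := hD
      have hil : i = l := by
        by_contra hil
        exact hD' ⟨i, by rwa [Function.update_of_ne hil], fun j hj => hmax j (hup hk hj).2⟩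
      subst hil
      funext j
      rcases eq_or_ne j i with rfl | hj
      · simp
      · rw [Function.update_of_ne hj, Function.update_of_ne hj, Equiv.swap_apply_of_ne_of_ne]
        · intro h
          have := hmax j h
          rw [Fin.lt_def] at this
          omega
        · exact fun h => hj (hv.2 j i (h.trans hi.symm) (by omega))
  · rw [if_neg hD, if_neg]
    rintro ⟨i, hi, hmax⟩
    obtain ⟨hil, hi'⟩ := hup (Nat.succ_ne_zero k) hi
    refine hD ⟨i, hi', fun j hj => ?_⟩
    rcases eq_or_ne j l with rfl | hjl
    · have := Fin.val_ne_of_ne hil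
      rw [Fin.lt_def]
      omega
    · exact hmax j (by rwa [Function.update_of_ne hjl])

theorem leftAct_zeroAct_of_ne_zero {v : Fin n → ℕ} (hv : IsRookVector v) {k : ℕ} (hk : k ≠ 0)
    {l : Fin n} (hl : l.val ≠ 0) : leftAct k (zeroAct l v) = zeroAct l (leftAct k v) := by
  have hz : ∀ w : Fin n → ℕ, zeroAct l w = if w (prevIdx l) < w l then act l w else w :=
    fun w => by simp only [zeroAct, hl, false_or]
  have hp : prevIdx l < l := by
    rw [Fin.lt_def, prevIdx_val]
    omega
  rw [hz, hz, leftAct, leftAct, if_neg hk, if_neg hk]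
  by_cases hlt : v (prevIdx l) < v l
  · rw [if_pos hlt]
    have hiff := leftAsc_act_iff hv k hl hlt
    by_cases hD : LeftAsc k v
    · by_cases hex : v (prevIdx l) = k ∧ v l = k + 1
      · -- Exchanging the adjacent entries `k` and `k + 1` is the same as exchanging the values.
        rw [if_neg fun h => (hiff.1 h).2 hex]
        simp only [hD, hex, if_true, Equiv.swap_apply_left, Equiv.swap_apply_right]
        rw [if_neg (by omega), act_pos hl]
        funext i
        have h1 : v i = k → i = prevIdx l := fun h => hv.2 _ _ (h.trans hex.1.symm) (by omega)
        have h2 : v i = k + 1 → i = l := fun h => hv.2 _ _ (h.trans hex.2.symm) (by omega)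
        simp only [Function.comp, Equiv.swap_apply_def]
        split_ifs <;> grind
      · rw [if_pos (hiff.2 ⟨hD, hex⟩)]
        simp only [hD, if_true]
        rw [if_pos]
        · rw [act_pos hl, act_pos hl]
          rfl
        · simp only [Equiv.swap_apply_def]
          split_ifs <;> omega
    · rw [if_neg fun h => hD (hiff.1 h).1]
      simp only [hD, if_false, hlt, if_true]
  · rw [if_neg hlt]
    by_cases hD : LeftAsc k v
    · have hex : ¬ (v l = k ∧ v (prevIdx l) = k + 1) := by
        rintro ⟨h1, h2⟩
        obtain ⟨i, hi, hmax⟩ := hD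
        obtain rfl := hv.2 _ _ (hi.trans h2.symm) (by omega)
        exact absurd (hmax l h1) hp.not_gt
      simp only [hD, if_true]
      rw [if_neg]
      simp only [Equiv.swap_apply_def]
      split_ifs <;> omega
    · simp only [hD, if_false, hlt]

theorem leftAct_zeroAct {v : Fin n → ℕ} (hv : IsRookVector v) (k : ℕ) (l : Fin n) :
    leftAct k (zeroAct l v) = zeroAct l (leftAct k v) := by
  rcases eq_or_ne k 0 with rfl | hk
  · simp only [leftAct, if_true, zeroAct]
    by_cases hl : l.val = 0
    · simp only [hl, true_or, if_true, act_zero hl]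
      funext i
      rcases eq_or_ne i l with rfl | hi
      · simp
      · simp [hi]
    · simp only [hl, false_or, act_pos hl]
      -- The comparison of two entries changes only for the entries `0` and `1`, which become equal.
      funext i
      split_ifs <;> simp only [Function.comp, Equiv.swap_apply_def] at * <;> grind
  · by_cases hl : l.val = 0
    · exact leftAct_zeroAct_of_eq_zero hv hk hl
    · exact leftAct_zeroAct_of_ne_zero hv hk hl

/-- The action of a word on any rook is determined by its action on the identity: reaching `v` from
the identity by right operators amounts to reaching it by left operators, and these commute with
the action of the word. -/
theorem run_zeroAct_congr {u w : FreeMonoid (Fin n)}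
    (h : run zeroAct (idVector n) u = run zeroAct (idVector n) w) {v : Fin n → ℕ}
    (hv : IsRookVector v) : run zeroAct v u = run zeroAct v w := by
  have hcomm : ∀ (k : ℕ) (v : Fin n → ℕ), IsRookVector v → ∀ w,
      leftAct k (run zeroAct v w) = run zeroAct (leftAct k v) w := by
    intro k v hv w
    induction w using snoc_induction with
    | one => rfl
    | snoc w l ih =>
      rw [run_mul_of, run_mul_of, ← ih,
        leftAct_zeroAct (isAscAction_zeroAct.isRookVector_run hv w)]
  have key : ∀ c : FreeMonoid (Fin n), ∃ F : (Fin n → ℕ) → Fin n → ℕ, ∀ w,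
      run zeroAct (run zeroAct (idVector n) c) w = F (run zeroAct (idVector n) w) := by
    intro c
    induction c using snoc_induction with
    | one => exact ⟨id, fun w => rfl⟩
    | snoc c k ih =>
      obtain ⟨F, hF⟩ := ih
      refine ⟨fun v => F (leftAct k.val v), fun w => ?_⟩
      rw [run_mul_of, ← run_of_mul, hF, run_of_mul, ← leftAct_idVector,
        ← hcomm k _ (isRookVector_idVector n)]
  obtain ⟨c, hc⟩ := exists_ascWord hv
  obtain ⟨F, hF⟩ := key c
  rw [← isAscAction_zeroAct.run_eq hc, hF, hF, h]

/-! ### Rook matrices and rook vectors -/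

theorem rookMatrix_apply_eq_one_iff (r : rookMonoid n) (i j : Fin n) :
    r.1 i j = 1 ↔ rookVector r j = i.val + 1 := by
  have hone : ∀ i, r.1 i j = 1 → rookVector r j = i.val + 1 := by
    intro i h
    rw [rookVector, Finset.sum_eq_single i, if_pos h]
    · intro i' _ hne
      refine if_neg fun h' => hne ?_
      exact r.2.2.2 i' i j (by rw [h']; exact one_ne_zero) (by rw [h]; exact one_ne_zero)
    · simp
  refine ⟨hone i, fun h => ?_⟩
  have hne : rookVector r j ≠ 0 := by omega
  obtain ⟨i', -, hi'⟩ := Finset.exists_ne_zero_of_sum_ne_zero hne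
  rw [ne_eq, ite_eq_right_iff, not_forall] at hi'
  obtain ⟨hi', -⟩ := hi'
  have := hone i' hi'
  rwa [show i = i' from Fin.ext (by omega)]

theorem rookVector_injective : Function.Injective (rookVector (n := n)) := by
  intro r s h
  refine Subtype.ext (Matrix.ext fun i j => ?_)
  have h1 := rookMatrix_apply_eq_one_iff r i j
  rw [h, ← rookMatrix_apply_eq_one_iff s i j] at h1
  have h2 := r.2.1 i j
  have h3 := s.2.1 i j
  omega

theorem rookVector_eq_zero_or (r : rookMonoid n) (j : Fin n) :
    rookVector r j = 0 ∨ ∃ i, r.1 i j = 1 := by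
  by_cases h : rookVector r j = 0
  · exact Or.inl h
  · obtain ⟨i, -, hi⟩ := Finset.exists_ne_zero_of_sum_ne_zero h
    rw [ne_eq, ite_eq_right_iff, not_forall] at hi
    exact Or.inr ⟨i, hi.1⟩

theorem isRookVector_rookVector (r : rookMonoid n) : IsRookVector (rookVector r) := by
  refine ⟨fun j => ?_, fun i j h h0 => ?_⟩
  · rcases rookVector_eq_zero_or r j with h | ⟨i, h⟩
    · omega
    · rw [rookMatrix_apply_eq_one_iff] at h
      omega
  · obtain ⟨l, hl⟩ := (rookVector_eq_zero_or r i).resolve_left h0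
    have hl' := (rookMatrix_apply_eq_one_iff r l j).2
      (h ▸ (rookMatrix_apply_eq_one_iff r l i).1 hl)
    exact r.2.2.1 l i j (by omega) (by omega)

theorem rookVector_one : rookVector (1 : rookMonoid n) = idVector n := by
  funext j
  exact (rookMatrix_apply_eq_one_iff 1 j j).1 (Matrix.one_apply_eq j)

theorem rookVector_mul_rookGen (r : rookMonoid n) (k : Fin n) :
    rookVector (r * rookGen n k) = act k (rookVector r) := by
  funext j
  by_cases hk : k.val = 0
  · rw [act_zero hk, Function.update_apply]
    simp only [rookVector, rookGen, rookGenMatrix, if_pos hk, Submonoid.coe_mul,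
      Matrix.mul_diagonal]
    have : (j : ℕ) = 0 ↔ j = k := by rw [Fin.ext_iff, hk]
    simp only [this]
    by_cases hj : j = k <;> simp [hj]
  · rw [act_pos hk]
    simp only [rookVector, rookGen, rookGenMatrix, if_neg hk, Submonoid.coe_mul, Function.comp,
      Matrix.swap, Equiv.Perm.permMatrix, PEquiv.mul_toMatrix_toPEquiv, Matrix.submatrix_apply,
      Equiv.symm_swap, id]

theorem rookVector_zeroRookOp (r : rookMonoid n) (k : Fin n) :
    rookVector (zeroRookOp k r) = zeroAct k (rookVector r) := by
  rw [zeroRookOp, zeroAct]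
  split_ifs
  exacts [rookVector_mul_rookGen r k, rfl]

theorem rookVector_lift (w : FreeMonoid (Fin n)) :
    rookVector (FreeMonoid.lift (rookGen n) w) = run act (idVector n) w := by
  induction w using snoc_induction with
  | one => rw [map_one, rookVector_one, run_one]
  | snoc w k ih =>
    rw [map_mul, FreeMonoid.lift_eval_of, rookVector_mul_rookGen, ih, run_mul_of]

theorem rookVector_zeroRookAct (r : rookMonoid n) (w : FreeMonoid (Fin n)) :
    rookVector (zeroRookAct r (FreeMonoid.lift (zeroRookGen n) w)) =
      run zeroAct (rookVector r) w := by
  induction w using snoc_induction with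
  | one => rw [map_one, run_one]; rfl
  | snoc w k ih =>
    rw [map_mul, FreeMonoid.lift_eval_of, run_mul_of, ← ih, ← rookVector_zeroRookOp]
    rfl

theorem lift_rookGen_eq_iff (u w : FreeMonoid (Fin n)) :
    FreeMonoid.lift (rookGen n) u = FreeMonoid.lift (rookGen n) w ↔
      run act (idVector n) u = run act (idVector n) w := by
  rw [← rookVector_lift, ← rookVector_lift, rookVector_injective.eq_iff]

theorem lift_zeroRookGen_eq_iff (u w : FreeMonoid (Fin n)) :
    FreeMonoid.lift (zeroRookGen n) u = FreeMonoid.lift (zeroRookGen n) w ↔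
      run zeroAct (idVector n) u = run zeroAct (idVector n) w := by
  constructor
  · intro h
    rw [← rookVector_one, ← rookVector_zeroRookAct, h, rookVector_zeroRookAct]
  · intro h
    refine Subtype.ext (MulOpposite.unop_injective (funext fun r => rookVector_injective ?_))
    have := run_zeroAct_congr h (isRookVector_rookVector r)
    rwa [← rookVector_zeroRookAct, ← rookVector_zeroRookAct] at this

theorem isReducedWord_rookGen_iff {w : FreeMonoid (Fin n)} :
    IsReducedWord (rookGen n) w ↔ ∃ v, AscWord w v := by
  rw [isAscAction_act.isReducedWord_iff lift_rookGen_eq_iff]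
  exact ⟨fun h => ⟨_, h⟩, fun ⟨v, h⟩ => by rwa [isAscAction_act.run_eq h]⟩

theorem isReducedWord_zeroRookGen_iff {w : FreeMonoid (Fin n)} :
    IsReducedWord (zeroRookGen n) w ↔ ∃ v, AscWord w v := by
  rw [isAscAction_zeroAct.isReducedWord_iff lift_zeroRookGen_eq_iff]
  exact ⟨fun h => ⟨_, h⟩, fun ⟨v, h⟩ => by rwa [isAscAction_zeroAct.run_eq h]⟩

theorem AscWord.rookVector_zeroRookAct_one {w : FreeMonoid (Fin n)} {v : Fin n → ℕ}
    (h : AscWord w v) :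
    rookVector (zeroRookAct 1 (FreeMonoid.lift (zeroRookGen n) w)) = v := by
  rw [rookVector_zeroRookAct, rookVector_one, isAscAction_zeroAct.run_eq h]

end RookWord

theorem mainTheorem2 (n : ℕ) :
    (∀ (r : rookMonoid n) (u v : FreeMonoid (Fin n)),
      IsReducedWordFor (rookGen n) u r → IsReducedWordFor (rookGen n) v r → braidCon n u v) ∧
    (∀ (x : zeroRookMonoid n) (u v : FreeMonoid (Fin n)),
      IsReducedWordFor (zeroRookGen n) u x → IsReducedWordFor (zeroRookGen n) v x →
        braidCon n u v) ∧
    (∀ w : FreeMonoid (Fin n),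
      IsReducedWord (rookGen n) w ↔ IsReducedWord (zeroRookGen n) w) ∧
    (∀ w : FreeMonoid (Fin n), IsReducedWord (rookGen n) w →
      (∀ k ≤ w.length, FreeMonoid.lift (rookGen n) (wordPrefix w k) =
        zeroRookAct 1 (FreeMonoid.lift (zeroRookGen n) (wordPrefix w k))) ∧
      Set.InjOn
        (fun k : ℕ => zeroRookAct 1 (FreeMonoid.lift (zeroRookGen n) (wordPrefix w k)))
        (Set.Iic w.length)) := by
  refine ⟨fun r u v => RookWord.isAscAction_act.braidCon_of_isReducedWordFor
      RookWord.lift_rookGen_eq_iff,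
    fun x u v => RookWord.isAscAction_zeroAct.braidCon_of_isReducedWordFor
      RookWord.lift_zeroRookGen_eq_iff,
    fun w => RookWord.isReducedWord_rookGen_iff.trans RookWord.isReducedWord_zeroRookGen_iff.symm,
    fun w hw => ?_⟩
  obtain ⟨v, hv⟩ := RookWord.isReducedWord_rookGen_iff.1 hw
  refine ⟨fun k hk => ?_, fun k hk l hl e => ?_⟩
  · obtain ⟨u, hu⟩ := hv.wordPrefix k hk
    refine RookWord.rookVector_injective ?_
    rw [RookWord.rookVector_lift, RookWord.isAscAction_act.run_eq hu,
      hu.rookVector_zeroRookAct_one]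
  · -- The length of a prefix can be read off from the level of its value.
    obtain ⟨u, hu⟩ := hv.wordPrefix k hk
    obtain ⟨u', hu'⟩ := hv.wordPrefix l hl
    have h := congrArg rookVector e
    simp only [hu.rookVector_zeroRookAct_one, hu'.rookVector_zeroRookAct_one] at h
    have h1 := hu.level_eq
    have h2 := hu'.level_eq
    rw [RookWord.length_wordPrefix hk] at h1
    rw [RookWord.length_wordPrefix hl, ← h] at h2
    omega
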